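/- Let $\varepsilon,\mu:\mathbb R\to\mathbb C^{2\times 2}$ be bounded, $1$-periodic and piecewise continuous (the transverse permittivity and permeability of a one-dimensional photonic crystal). Put $Q=\begin{pmatrix}0&-1\\1&0\end{pmatrix}$, $\mathcal Q=\operatorname{diag}(Q,Q)$ and $\mathcal A(z)=\mathrm i\begin{pmatrix}0&\mu(z)\\-\varepsilon(z)&0\end{pmatrix}$. For $\xi\in\mathbb T=\{|\xi|=1\}$, call $\omega\in\mathbb C$ an eigenfrequency at $\xi$ if there is a continuous function $\Phi:\mathbb R\to\mathbb C^4$, $\Phi\not\equiv0$, with $\Phi'=\omega\,\mathcal Q^{-1}\mathcal A(z)\Phi$ (away from the discontinuities of $\varepsilon,\mu$) and $\Phi(z+1)=\xi\,\Phi(z)$ for all $z$. Let $\omega_n:\mathbb T\to\mathbb C$ be a spectral band, that is, a continuous function such that $\omega_n(\xi)$ is an eigenfrequency at $\xi$ for every $\xi\in\mathbb T$. Assume that $k\mapsto\omega_n(e^{\mathrm ik})$ is $C^1$ except at finitely many points of $\mathbb T$, with derivative integrable over a period. Let $\gamma_n=\omega_n(\mathbb T)$, let $D_n^e$ be the unbounded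 connected component of $\mathbb C\setminus\gamma_n$, and let $D_n^i$ be a bounded connected component whose boundary $\gamma_n^i=\partial D_n^i$ is a simple closed curve. Call $\omega_n(\xi_0)$, $\xi_0=e^{\mathrm ik_0}$, a smooth point if $k\mapsto\omega_n(e^{\mathrm ik})$ is $C^1$ near $k_0$, the tangent vector $\tau(\xi_0)=\frac{d}{dk}\omega_n(e^{\mathrm ik})\big|_{k=k_0}$ is nonzero, and $\omega_n(\xi)\ne\omega_n(\xi_0)$ for all $\xi\neq\xi_0$. Assume that all but finitely many points of $\gamma_n^i$ are smooth points, and that at every smooth point $\zeta\in\gamma_n^i$ there is an outward unit normal, i.e. a unit vector $\nu$ orthogonal to the tangent vector with $\zeta+t\nu\in D_n^e$ for all sufficiently small $t>0$. Say that $\gamma_n^i$ is positively oriented if, at every smooth point $\omega_n(\xi_0)\in\gamma_n^i$, the outward unit normal is the rotation of $\tau(\xi_0)/|\tau(\xi_0)|$ by $\pi/2$ clockwise, and negatively oriented otherwise. If $\gamma_n^i$ is positively oriented, then for every $\omega_B\in D_n^i$ $$W(\gamma_n;\omega_B)=\frac1{2\pi\mathrm i}\int_{\mathbb T}\frac{d\omega_n(\xi)}{\omega_n(\xi)-\omega_B}=\frac1{2\pi\mathrm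 i}\int_{-\pi}^{\pi}\frac{\frac{d}{dk}\omega_n(e^{\mathrm ik})}{\omega_n(e^{\mathrm ik})-\omega_B}\,dk=1 .$$ If $\gamma_n^i$ is negatively oriented, then $W(\gamma_n;\omega_B)=-1$ for every $\omega_B\in D_n^i$. -/

import Mathlib

open Set Filter Topology

noncomputable section

/-- A one-dimensional photonic crystal of period `1`. The fields `eps`, `mu` are the transverse
`2 × 2` blocks of the permittivity and permeability tensors, which are the only blocks that enter
the equations for waves propagating in the `z` direction. -/
structure PhotonicCrystal where
  eps : ℝ → Matrix (Fin 2) (Fin 2) ℂ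
  mu : ℝ → Matrix (Fin 2) (Fin 2) ℂ
  eps_periodic : ∀ z, eps (z + 1) = eps z
  mu_periodic : ∀ z, mu (z + 1) = mu z
  eps_bounded : ∃ C : ℝ, ∀ z i j, ‖eps z i j‖ ≤ C
  mu_bounded : ∃ C : ℝ, ∀ z i j, ‖mu z i j‖ ≤ C
  eps_piecewise : {z : ℝ | z ∈ Ico (0 : ℝ) 1 ∧ ¬ ContinuousAt eps z}.Finite
  mu_piecewise : {z : ℝ | z ∈ Ico (0 : ℝ) 1 ∧ ¬ ContinuousAt mu z}.Finite

namespace PhotonicCrystal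

/-- The rotation matrix `Q`. -/
def Q : Matrix (Fin 2) (Fin 2) ℂ := !![0, -1; 1, 0]

/-- The block diagonal matrix `diag(Q, Q)`. -/
def bigQ : Matrix (Fin 2 ⊕ Fin 2) (Fin 2 ⊕ Fin 2) ℂ := Matrix.fromBlocks Q 0 0 Q

/-- The matrix `i [[0, μ(z)], [-ε(z), 0]]`. -/
def A (pc : PhotonicCrystal) (z : ℝ) : Matrix (Fin 2 ⊕ Fin 2) (Fin 2 ⊕ Fin 2) ℂ :=
  Complex.I • Matrix.fromBlocks 0 (pc.mu z) (-pc.eps z) 0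

/-- `Φ = (E, H)` solves `Φ' = w 𝒬⁻¹ A(z) Φ` on the line: it is continuous and the equation holds
at every point where the medium is continuous. -/
def IsSolution (pc : PhotonicCrystal) (w : ℂ) (Φ : ℝ → (Fin 2 ⊕ Fin 2 → ℂ)) : Prop :=
  Continuous Φ ∧ ∀ z, ContinuousAt pc.eps z → ContinuousAt pc.mu z →
    HasDerivAt Φ (w • (bigQ⁻¹ * pc.A z).mulVec (Φ z)) z

/-- `w` is an eigenfrequency at the Bloch phase `ξ = e^{ik}`: there is a nonzero Bloch mode. -/
def IsEigenfrequency (pc : PhotonicCrystal) (ξ : Circle) (w : ℂ) : Prop :=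
  ∃ Φ : ℝ → (Fin 2 ⊕ Fin 2 → ℂ), Φ ≠ 0 ∧ pc.IsSolution w Φ ∧
    ∀ z, Φ (z + 1) = (ξ : ℂ) • Φ z

/-- A spectral band: a continuous function on the unit circle (the Brillouin zone) whose value at
each `ξ` is an eigenfrequency at `ξ`. -/
def IsBand (pc : PhotonicCrystal) (ω : Circle → ℂ) : Prop :=
  Continuous ω ∧ ∀ ξ, pc.IsEigenfrequency ξ (ω ξ)

end PhotonicCrystal

/-! ### Closed curves parametrized by the unit circle -/

/-- The tangent vector `d/dk ω(e^{ik})` at the point `ξ` of the unit circle. -/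
def loopTangent (ω : Circle → ℂ) (ξ : Circle) : ℂ :=
  deriv (fun t : ℝ => ω (ξ * Circle.exp t)) 0

/-- `k ↦ ω(e^{ik})` is continuously differentiable in a neighborhood of `ξ`. -/
def IsC1At (ω : Circle → ℂ) (ξ : Circle) : Prop :=
  ContDiffAt ℝ 1 (fun t : ℝ => ω (ξ * Circle.exp t)) 0

/-- `ω` is continuously differentiable except at finitely many points, with integrable
derivative, so that contour integrals along `ω` make sense. -/
def IsPiecewiseC1 (ω : Circle → ℂ) : Prop :=
  {ξ : Circle | ¬ IsC1At ω ξ}.Finite ∧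
    IntervalIntegrable (fun k : ℝ => loopTangent ω (Circle.exp k)) MeasureTheory.volume
      (-Real.pi) Real.pi

/-- The winding number `(2πi)⁻¹ ∮ dω(ξ) / (ω(ξ) - w)` of the closed curve `ω` around `w`. -/
def windingNumber (ω : Circle → ℂ) (w : ℂ) : ℂ :=
  (2 * Real.pi * Complex.I)⁻¹ *
    ∫ k in (-Real.pi)..Real.pi, loopTangent ω (Circle.exp k) / (ω (Circle.exp k) - w)

/-- `D` is a bounded connected component of the complement of `K`. -/
def IsBoundedComponent (K D : Set ℂ) : Prop :=
  (∃ w ∈ Kᶜ, D = connectedComponentIn Kᶜ w) ∧ Bornology.IsBounded D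

/-- The union of the unbounded connected components of the complement of `K`; for compact `K`
this is the unique unbounded component. -/
def exteriorComponent (K : Set ℂ) : Set ℂ :=
  {w | w ∈ Kᶜ ∧ ¬ Bornology.IsBounded (connectedComponentIn Kᶜ w)}

/-- `J` is a simple closed curve in the plane. -/
def IsSimpleClosedCurve (J : Set ℂ) : Prop :=
  ∃ c : Circle → ℂ, Continuous c ∧ Function.Injective c ∧ range c = J

/-- `ω ξ` is a smooth point of the curve: near `ξ` the parametrization is continuously
differentiable, its derivative does not vanish, and `ω ξ` is not a point of self-intersection. -/
def IsSmoothPoint (ω : Circle → ℂ) (ξ : Circle) : Prop :=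
  IsC1At ω ξ ∧ loopTangent ω ξ ≠ 0 ∧ ∀ η, ω η = ω ξ → η = ξ

/-- `ν` is a unit normal to the curve at `ω ξ` that points into the unbounded component. -/
def IsOutwardUnitNormal (ω : Circle → ℂ) (ξ : Circle) (ν : ℂ) : Prop :=
  ‖ν‖ = 1 ∧ inner ℝ ν (loopTangent ω ξ) = 0 ∧
    ∀ᶠ t : ℝ in 𝓝[>] 0, ω ξ + (t : ℂ) * ν ∈ exteriorComponent (range ω)

/-- The boundary of `D` is a simple closed curve, smooth except for finitely many corners, and at
every smooth point one of its normals points into the unbounded component. -/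
structure HasJordanBoundary (ω : Circle → ℂ) (D : Set ℂ) : Prop where
  simple : IsSimpleClosedCurve (frontier D)
  corners : {ζ : ℂ | ζ ∈ frontier D ∧ ¬ ∃ ξ, ω ξ = ζ ∧ IsSmoothPoint ω ξ}.Finite
  normal : ∀ ξ, ω ξ ∈ frontier D → IsSmoothPoint ω ξ → ∃ ν, IsOutwardUnitNormal ω ξ ν

/-- The boundary of `D` is positively oriented under `ω`: at each of its smooth points the outward
unit normal is the clockwise rotation by `π/2` of the unit tangent vector. -/
def IsPositivelyOriented (ω : Circle → ℂ) (D : Set ℂ) : Prop :=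
  ∀ ξ, ω ξ ∈ frontier D → IsSmoothPoint ω ξ → ∀ ν, IsOutwardUnitNormal ω ξ ν →
    ν = -Complex.I * (loopTangent ω ξ / (‖loopTangent ω ξ‖ : ℂ))

/-- The boundary of `D` is negatively oriented if it is not positively oriented. -/
def IsNegativelyOriented (ω : Circle → ℂ) (D : Set ℂ) : Prop :=
  ¬ IsPositivelyOriented ω D

end

/-!
A single smooth point of `∂D` determines the winding number in `D`, so neither the Jordan curve
theorem nor the integrality of winding numbers is needed; of the photonic crystal only the
continuity of the band enters.

For `w₁, w₂` off the curve, `log ((ω - w₁) / (ω - w₂))` is a primitive of the difference of the two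
winding integrands, and the quotient meets the cut of the logarithm exactly when `ω` meets the
segment `[w₁, w₂]` (`windingNumber_sub_eq`). If the segment avoids the curve, periodicity makes the
difference vanish, so the winding number is constant on connected subsets of the complement. It
vanishes far away, hence on the exterior component. If the curve crosses the segment at exactly one
parameter and passes from one side to the other there, the logarithm runs from `±πi` to `∓πi` along
one turn, and the winding number jumps by `±1` (`windingNumber_sub_eq_of_crossing`).

A smooth point in `∂D` exists because a simple closed curve is infinite and there are only finitely
many corners. Strict differentiability and the absence of self-intersections show that there the
curve is locally a single arc inside narrow cones around its tangent, so a short normal segment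
crosses it once, and every nearby point off the curve can be joined off the curve to one of the two
endpoints of the segment (`exists_isPreconnected_of_cone`). One endpoint lies in the exterior; since
`D` is bounded and accumulates at the smooth point, the other one lies in `D`. Hence the winding
number in `D` is the jump, whose sign tells whether the outward normal is the clockwise or the
counterclockwise rotation of the tangent (`windingNumber_eq_of_isSmoothPoint`).
-/

/-! ### Integrals of logarithmic derivatives -/

/-- If `g` stays in the slit plane on `(a, b)` and has logarithmic derivative `L` off a countable
set, then `log ∘ g` is a primitive of `L`, also when `g` reaches the cut at the endpoints. -/
theorem integral_eq_sub_of_tendsto_log {g L : ℝ → ℂ} {a b : ℝ} {S : Set ℝ} {A B : ℂ}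
    (hab : a < b) (hS : S.Countable) (hg : ContinuousOn g (Ioo a b))
    (hslit : ∀ k ∈ Ioo a b, g k ∈ Complex.slitPlane)
    (hd : ∀ k ∉ S, HasDerivAt g (L k * g k) k)
    (hi : IntervalIntegrable L MeasureTheory.volume a b)
    (hA : Tendsto (fun k => Complex.log (g k)) (𝓝[>] a) (𝓝 A))
    (hB : Tendsto (fun k => Complex.log (g k)) (𝓝[<] b) (𝓝 B)) :
    ∫ k in a..b, L k = B - A := by
  have hlog : ContinuousOn (fun k => Complex.log (g k)) (Ioo a b) := hg.clog hslit
  have hF := continuousOn_Icc_extendFrom_Ioo hlog hA hB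
  rw [MeasureTheory.integral_eq_of_hasDerivAt_off_countable_of_le _ L hab.le hS hF ?_ hi,
    eq_lim_at_left_extendFrom_Ioo hab hA, eq_lim_at_right_extendFrom_Ioo hab hB]
  rintro k ⟨hk, hkS⟩
  have hne : g k ≠ 0 := Complex.slitPlane_ne_zero (hslit k hk)
  have h := (hd k hkS).clog_real (hslit k hk)
  rw [mul_div_cancel_right₀ _ hne] at h
  refine h.congr_of_eventuallyEq ?_
  filter_upwards [isOpen_Ioo.mem_nhds hk] with x hx
  exact extendFrom_extends hlog x hx

/-- The two one-sided limits of the logarithm at the point `-1` of its cut. -/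
theorem tendsto_log_of_tendsto_neg_one {α : Type*} {l : Filter α} {q : α → ℂ} {s : ℝ}
    (hs : s = 1 ∨ s = -1) (hq : Tendsto q l (𝓝 (-1))) (him : ∀ᶠ x in l, 0 < s * (q x).im) :
    Tendsto (fun x => Complex.log (q x)) l (𝓝 (s * (Real.pi * Complex.I))) := by
  rcases hs with rfl | rfl
  · have h := (Complex.tendsto_log_nhdsWithin_im_nonneg_of_re_neg_of_im_zero
      (z := -1) (by simp) (by simp)).comp (tendsto_nhdsWithin_iff.2
        ⟨hq, him.mono fun x hx => by simpa using (by linarith : 0 ≤ (q x).im)⟩)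
    simpa [Function.comp_def] using h
  · have h := (Complex.tendsto_log_nhdsWithin_im_neg_of_re_neg_of_im_zero
      (z := -1) (by simp) (by simp)).comp (tendsto_nhdsWithin_iff.2
        ⟨hq, him.mono fun x hx => by simpa using (by linarith : (q x).im < 0)⟩)
    simpa [Function.comp_def] using h

/-- `(z - w₁) / (z - w₂)` is a nonpositive real number only for `z` on the segment `[w₁, w₂]`. -/
theorem div_sub_mem_slitPlane {z w₁ w₂ : ℂ} (hz : z ∉ segment ℝ w₁ w₂) :
    (z - w₁) / (z - w₂) ∈ Complex.slitPlane := by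
  by_contra h
  have h₂ : z - w₂ ≠ 0 := fun h₀ => hz (sub_eq_zero.1 h₀ ▸ right_mem_segment ℝ w₁ w₂)
  simp only [Complex.mem_slitPlane_iff, not_or, not_lt, not_not] at h
  obtain ⟨hre, him⟩ := h
  set r : ℝ := ((z - w₁) / (z - w₂)).re with hr
  have hq : (z - w₁) / (z - w₂) = (r : ℂ) := Complex.ext (by simp [hr]) (by simp [him])
  rw [div_eq_iff h₂] at hq
  have hpos : (0 : ℝ) < 1 - r := by linarith
  have hne : (1 - r : ℂ) ≠ 0 := by exact_mod_cast hpos.ne'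
  refine hz ⟨1 / (1 - r), -r / (1 - r), by positivity,
    div_nonneg (by linarith) hpos.le, by field_simp; ring, ?_⟩
  simp only [Complex.real_smul]
  push_cast
  field_simp
  linear_combination -hq

/-! ### Winding numbers of piecewise `C¹` loops -/

theorem loopTangent_exp (ω : Circle → ℂ) (k : ℝ) :
    loopTangent ω (Circle.exp k) = deriv (fun k : ℝ => ω (Circle.exp k)) k := by
  have h := deriv_comp_const_add (fun k : ℝ => ω (Circle.exp k)) k 0
  simpa [loopTangent, ← Circle.exp_add] using h

theorem IsC1At.hasDerivAt {ω : Circle → ℂ} {k : ℝ} (h : IsC1At ω (Circle.exp k)) :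
    HasDerivAt (fun k : ℝ => ω (Circle.exp k)) (loopTangent ω (Circle.exp k)) k := by
  rw [loopTangent_exp]
  have h₀ : DifferentiableAt ℝ (fun t : ℝ => ω (Circle.exp (k + t))) (k - k) := by
    simpa [IsC1At, Circle.exp_add] using ContDiffAt.differentiableAt h one_ne_zero
  have h₁ := DifferentiableAt.comp (f := fun x : ℝ => x - k) k h₀ (differentiableAt_id.sub_const k)
  exact (h₁.congr_of_eventuallyEq (Eventually.of_forall fun x => by simp)).hasDerivAt

theorem Set.Finite.countable_preimage_circleExp {S : Set Circle} (hS : S.Finite) :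
    (Circle.exp ⁻¹' S).Countable := by
  rw [← Set.biUnion_preimage_singleton]
  refine hS.countable.biUnion fun ξ _ => ?_
  refine (Set.countable_range fun m : ℤ => Complex.arg ξ + m * (2 * Real.pi)).mono fun k hk => ?_
  obtain ⟨m, hm⟩ := Circle.exp_eq_exp.1
    (show Circle.exp k = Circle.exp (Complex.arg ξ) by rw [Circle.exp_arg]; exact hk)
  exact ⟨m, hm.symm⟩

theorem IsPiecewiseC1.intervalIntegrable_div {ω : Circle → ℂ} (hω : IsPiecewiseC1 ω)
    (hc : Continuous ω) {w : ℂ} (hw : w ∉ range ω) (a b : ℝ) :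
    IntervalIntegrable (fun k : ℝ => loopTangent ω (Circle.exp k) / (ω (Circle.exp k) - w))
      MeasureTheory.volume a b := by
  have hper : Function.Periodic (fun k : ℝ => loopTangent ω (Circle.exp k)) (2 * Real.pi) :=
    fun k => by simp
  have h₁ := hper.intervalIntegrable (t := -Real.pi) (by positivity)
    (by convert hω.2 using 1; ring) a b
  simp only [div_eq_mul_inv]
  refine h₁.mul_continuousOn (Continuous.continuousOn ?_)
  exact ((hc.comp Circle.exp.continuous).sub continuous_const).inv₀
    fun k => sub_ne_zero.2 fun h => hw ⟨_, h⟩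

/-- The contour integral may start at any point of the loop. -/
theorem windingNumber_eq_integral (ω : Circle → ℂ) (w : ℂ) (a : ℝ) :
    windingNumber ω w = (2 * Real.pi * Complex.I)⁻¹ *
      ∫ k in a..a + 2 * Real.pi, loopTangent ω (Circle.exp k) / (ω (Circle.exp k) - w) := by
  have hper : Function.Periodic
      (fun k : ℝ => loopTangent ω (Circle.exp k) / (ω (Circle.exp k) - w)) (2 * Real.pi) :=
    fun k => by simp
  rw [windingNumber, ← hper.intervalIntegral_add_eq (-Real.pi) a]
  congr 2
  ring

/-- The difference of two winding numbers is the increment of `log ((ω - w₁) / (ω - w₂))` along one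
turn, as long as this quotient meets the cut of the logarithm at most at the starting point. -/
theorem windingNumber_sub_eq {ω : Circle → ℂ} (hω : IsPiecewiseC1 ω) (hc : Continuous ω)
    {w₁ w₂ : ℂ} (h₁ : w₁ ∉ range ω) (h₂ : w₂ ∉ range ω) {a : ℝ} {A B : ℂ}
    (hseg : ∀ k ∈ Ioo a (a + 2 * Real.pi), ω (Circle.exp k) ∉ segment ℝ w₁ w₂)
    (hA : Tendsto (fun k : ℝ => Complex.log ((ω (Circle.exp k) - w₁) / (ω (Circle.exp k) - w₂)))
      (𝓝[>] a) (𝓝 A))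
    (hB : Tendsto (fun k : ℝ => Complex.log ((ω (Circle.exp k) - w₁) / (ω (Circle.exp k) - w₂)))
      (𝓝[<] (a + 2 * Real.pi)) (𝓝 B)) :
    windingNumber ω w₁ - windingNumber ω w₂ = (2 * Real.pi * Complex.I)⁻¹ * (B - A) := by
  have hn₁ : ∀ k : ℝ, ω (Circle.exp k) - w₁ ≠ 0 := fun k => sub_ne_zero.2 fun h => h₁ ⟨_, h⟩
  have hn₂ : ∀ k : ℝ, ω (Circle.exp k) - w₂ ≠ 0 := fun k => sub_ne_zero.2 fun h => h₂ ⟨_, h⟩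
  have hγ : Continuous fun k : ℝ => ω (Circle.exp k) := hc.comp Circle.exp.continuous
  have hq : Continuous fun k : ℝ => (ω (Circle.exp k) - w₁) / (ω (Circle.exp k) - w₂) :=
    (hγ.sub continuous_const).div (hγ.sub continuous_const) hn₂
  have hi₁ := hω.intervalIntegrable_div hc h₁ a (a + 2 * Real.pi)
  have hi₂ := hω.intervalIntegrable_div hc h₂ a (a + 2 * Real.pi)
  rw [windingNumber_eq_integral ω w₁ a, windingNumber_eq_integral ω w₂ a, ← mul_sub,
    ← intervalIntegral.integral_sub hi₁ hi₂]
  congr 1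
  refine integral_eq_sub_of_tendsto_log (lt_add_of_pos_right a Real.two_pi_pos)
    hω.1.countable_preimage_circleExp
    hq.continuousOn (fun k hk => div_sub_mem_slitPlane (hseg k hk)) (fun k hk => ?_) (hi₁.sub hi₂) hA hB
  have hd : HasDerivAt (fun k : ℝ => ω (Circle.exp k)) (loopTangent ω (Circle.exp k)) k :=
    IsC1At.hasDerivAt (not_not.1 hk)
  refine ((hd.sub_const w₁).fun_div (hd.sub_const w₂) (hn₂ k)).congr_deriv ?_
  have := hn₁ k
  have := hn₂ k
  field_simp

theorem windingNumber_eq_of_segment {ω : Circle → ℂ} (hω : IsPiecewiseC1 ω) (hc : Continuous ω)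
    {w₁ w₂ : ℂ} (h : Disjoint (segment ℝ w₁ w₂) (range ω)) :
    windingNumber ω w₁ = windingNumber ω w₂ := by
  have hseg : ∀ k : ℝ, ω (Circle.exp k) ∉ segment ℝ w₁ w₂ :=
    fun k hk => h.le_bot ⟨hk, mem_range_self _⟩
  have h₁ : w₁ ∉ range ω := fun hw => h.le_bot ⟨left_mem_segment ℝ _ _, hw⟩
  have h₂ : w₂ ∉ range ω := fun hw => h.le_bot ⟨right_mem_segment ℝ _ _, hw⟩
  have hγ : Continuous fun k : ℝ => ω (Circle.exp k) := hc.comp Circle.exp.continuous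
  have hlog : Continuous fun k : ℝ =>
      Complex.log ((ω (Circle.exp k) - w₁) / (ω (Circle.exp k) - w₂)) :=
    ((hγ.sub continuous_const).div (hγ.sub continuous_const)
      fun k => sub_ne_zero.2 fun h => h₂ ⟨_, h⟩).clog fun k => div_sub_mem_slitPlane (hseg k)
  have := windingNumber_sub_eq hω hc h₁ h₂ (a := 0) (fun k _ => hseg k)
    ((hlog.tendsto _).mono_left nhdsWithin_le_nhds) ((hlog.tendsto _).mono_left nhdsWithin_le_nhds)
  rw [Circle.exp_add_two_pi] at this
  simpa [sub_eq_zero] using this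

theorem windingNumber_eq_of_isPreconnected {ω : Circle → ℂ} (hω : IsPiecewiseC1 ω)
    (hc : Continuous ω) {U : Set ℂ} (hU : IsPreconnected U) (hUω : U ⊆ (range ω)ᶜ) {w₁ w₂ : ℂ}
    (h₁ : w₁ ∈ U) (h₂ : w₂ ∈ U) : windingNumber ω w₁ = windingNumber ω w₂ := by
  refine hU.induction₂ (fun x y => windingNumber ω x = windingNumber ω y) (fun x hx => ?_)
    (fun _ _ _ _ _ _ => Eq.trans) (fun _ _ _ _ => Eq.symm) h₁ h₂
  obtain ⟨r, hr, hball⟩ := Metric.isOpen_iff.1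
    (isCompact_range hc).isClosed.isOpen_compl x (hUω hx)
  filter_upwards [mem_nhdsWithin_of_mem_nhds (Metric.ball_mem_nhds x hr)] with y hy
  refine windingNumber_eq_of_segment hω hc (Set.disjoint_left.2 fun z hz => ?_)
  exact hball ((convex_ball x r).segment_subset (Metric.mem_ball_self hr) hy hz)

/-- Outside a disc around `0` that contains the loop, `1 - ω / w` lies in the right half plane, so
its logarithm is a periodic primitive. -/
theorem windingNumber_eq_zero_of_norm_lt {ω : Circle → ℂ} (hω : IsPiecewiseC1 ω)
    (hc : Continuous ω) {w : ℂ} (hw : ∀ ξ, ‖ω ξ‖ < ‖w‖) : windingNumber ω w = 0 := by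
  have hw₀ : w ≠ 0 := norm_pos_iff.1 ((norm_nonneg _).trans_lt (hw 1))
  have hwr : w ∉ range ω := by rintro ⟨ξ, rfl⟩; exact lt_irrefl _ (hw ξ)
  have hn : ∀ k : ℝ, ω (Circle.exp k) - w ≠ 0 := fun k => sub_ne_zero.2 fun h => hwr ⟨_, h⟩
  have hγ : Continuous fun k : ℝ => ω (Circle.exp k) := hc.comp Circle.exp.continuous
  have hslit : ∀ k : ℝ, 1 + -(ω (Circle.exp k) / w) ∈ Complex.slitPlane := fun k =>
    Complex.mem_slitPlane_of_norm_lt_one (by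
      rw [norm_neg, norm_div]
      exact (div_lt_one (norm_pos_iff.2 hw₀)).2 (hw _))
  have hg : Continuous fun k : ℝ => 1 + -(ω (Circle.exp k) / w) :=
    continuous_const.add (hγ.div_const w).neg
  have hlog := hg.clog hslit
  have := integral_eq_sub_of_tendsto_log (lt_add_of_pos_right 0 Real.two_pi_pos)
    hω.1.countable_preimage_circleExp hg.continuousOn (fun k _ => hslit k) (fun k hk => ?_)
    (hω.intervalIntegrable_div hc hwr 0 (0 + 2 * Real.pi))
    ((hlog.tendsto _).mono_left nhdsWithin_le_nhds) ((hlog.tendsto _).mono_left nhdsWithin_le_nhds)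
  · rw [windingNumber_eq_integral ω w 0, this, Circle.exp_add_two_pi, sub_self, mul_zero]
  · have hd : HasDerivAt (fun k : ℝ => ω (Circle.exp k)) (loopTangent ω (Circle.exp k)) k :=
      IsC1At.hasDerivAt (not_not.1 hk)
    refine ((hd.div_const w).fun_neg.const_add 1).congr_deriv ?_
    have := hn k
    field_simp
    ring

theorem windingNumber_eq_zero_of_mem_exteriorComponent {ω : Circle → ℂ} (hω : IsPiecewiseC1 ω)
    (hc : Continuous ω) {w : ℂ} (hw : w ∈ exteriorComponent (range ω)) :
    windingNumber ω w = 0 := by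
  obtain ⟨R, hR⟩ := (isCompact_range hc).isBounded.exists_norm_le
  obtain ⟨z, hz, hzR⟩ : ∃ z ∈ connectedComponentIn (range ω)ᶜ w, R < ‖z‖ := by
    by_contra! h
    exact hw.2 (isBounded_iff_forall_norm_le.2 ⟨R, h⟩)
  rw [windingNumber_eq_of_isPreconnected hω hc isPreconnected_connectedComponentIn
    (connectedComponentIn_subset _ _) (mem_connectedComponentIn hw.1) hz]
  exact windingNumber_eq_zero_of_norm_lt hω hc fun ξ => (hR _ (mem_range_self ξ)).trans_lt hzR

/-! ### The jump across a smooth point -/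

theorem im_sub_div_add (p : ℂ) (t : ℝ) :
    ((p - t) / (p + t)).im = 2 * t * p.im / Complex.normSq (p + t) := by
  simp [Complex.div_im]
  ring

/-- If the loop crosses the segment `[ω ξ - tν, ω ξ + tν]` only at the parameter `ξ`, towards the
side `s * I * ν` of the line `ω ξ + ℝν`, then the winding number drops by `s` from the endpoint
`ω ξ - tν` to the endpoint `ω ξ + tν`. -/
theorem windingNumber_sub_eq_of_crossing {ω : Circle → ℂ} (hω : IsPiecewiseC1 ω)
    (hc : Continuous ω) {ξ : Circle} (hinj : ∀ η, ω η = ω ξ → η = ξ) {ν : ℂ} (hν : ν ≠ 0)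
    {t s : ℝ} (ht : 0 < t) (hs : s = 1 ∨ s = -1)
    (hseg : ∀ x : ℝ, |x| ≤ t → ω ξ + x * ν ∈ range ω → x = 0)
    (hside : ∀ᶠ h : ℝ in 𝓝[≠] 0, 0 < s * h * ((ω (ξ * Circle.exp h) - ω ξ) / ν).im) :
    windingNumber ω (ω ξ + t * ν) - windingNumber ω (ω ξ - t * ν) = -s := by
  have h₁ : ω ξ + t * ν ∉ range ω := fun h => ht.ne' (hseg t (abs_of_pos ht).le h)
  have h₂ : ω ξ - t * ν ∉ range ω := fun h =>
    ht.ne' (neg_eq_zero.1 (hseg (-t) (by rw [abs_neg, abs_of_pos ht]) (by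
      push_cast; rwa [neg_mul, ← sub_eq_add_neg])))
  have hn₂ : ∀ k : ℝ, ω (Circle.exp k) - (ω ξ - t * ν) ≠ 0 :=
    fun k => sub_ne_zero.2 fun h => h₂ ⟨_, h⟩
  set q : ℝ → ℂ := fun k =>
    (ω (Circle.exp k) - (ω ξ + t * ν)) / (ω (Circle.exp k) - (ω ξ - t * ν)) with hq
  have hγ : Continuous fun k : ℝ => ω (Circle.exp k) := hc.comp Circle.exp.continuous
  have hqc : Continuous q := (hγ.sub continuous_const).div (hγ.sub continuous_const) hn₂
  have hq_at : ∀ a : ℝ, Circle.exp a = ξ → q a = -1 := by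
    intro a ha
    have : (t : ℂ) * ν ≠ 0 := mul_ne_zero (by exact_mod_cast ht.ne') hν
    simp only [hq, ha, sub_sub_cancel, sub_add_cancel_left]
    rw [neg_div, div_self this]
  -- Near `ξ`, the imaginary part of the quotient has the sign `s` after and `-s` before `ξ`.
  have hq_im : ∀ a : ℝ, Circle.exp a = ξ → ∀ᶠ k in 𝓝[≠] a, 0 < s * (k - a) * (q k).im := by
    intro a ha
    have hlim : Tendsto (fun k : ℝ => k - a) (𝓝[≠] a) (𝓝[≠] 0) := by
      refine tendsto_nhdsWithin_iff.2 ⟨?_, ?_⟩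
      · have : Tendsto (fun k : ℝ => k - a) (𝓝 a) (𝓝 (a - a)) :=
          (continuous_id.sub continuous_const).tendsto a
        rw [sub_self] at this
        exact this.mono_left nhdsWithin_le_nhds
      · filter_upwards [self_mem_nhdsWithin] with k hk
        exact sub_ne_zero.2 hk
    filter_upwards [hlim.eventually hside] with k hk
    have hk' : ξ * Circle.exp (k - a) = Circle.exp k := by
      rw [← ha, ← Circle.exp_add, add_sub_cancel]
    rw [hk'] at hk
    set p := (ω (Circle.exp k) - ω ξ) / ν with hp
    have hqp : q k = (p - t) / (p + t) := by
      have e₁ : ω (Circle.exp k) - (ω ξ + t * ν) = (p - t) * ν := by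
        rw [sub_mul, hp, div_mul_cancel₀ _ hν]; ring
      have e₂ : ω (Circle.exp k) - (ω ξ - t * ν) = (p + t) * ν := by
        rw [add_mul, hp, div_mul_cancel₀ _ hν]; ring
      simp only [hq]
      rw [e₁, e₂, mul_div_mul_right _ _ hν]
    have hpt : p + t ≠ 0 := by
      intro h0
      apply hn₂ k
      have : ω (Circle.exp k) - (ω ξ - t * ν) = (p + t) * ν := by
        rw [add_mul, hp, div_mul_cancel₀ _ hν]; ring
      rw [this, h0, zero_mul]
    rw [hqp, im_sub_div_add]
    have hN : 0 < Complex.normSq (p + t) := Complex.normSq_pos.2 hpt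
    have : s * (k - a) * (2 * t * p.im / Complex.normSq (p + t)) =
        (s * (k - a) * p.im) * (2 * t / Complex.normSq (p + t)) := by ring
    rw [this]
    positivity
  obtain ⟨a, ha⟩ := Circle.exp_surjective ξ
  have hb : Circle.exp (a + 2 * Real.pi) = ξ := by rw [Circle.exp_add_two_pi, ha]
  have hA : Tendsto (fun k => Complex.log (q k)) (𝓝[>] a) (𝓝 (s * (Real.pi * Complex.I))) := by
    refine tendsto_log_of_tendsto_neg_one hs
      (hq_at a ha ▸ (hqc.tendsto a).mono_left nhdsWithin_le_nhds) ?_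
    filter_upwards [nhdsGT_le_nhdsNE a (hq_im a ha), self_mem_nhdsWithin] with k hk hka
    have hka : 0 < k - a := sub_pos.2 hka
    exact pos_of_mul_pos_left (by linarith : 0 < s * (q k).im * (k - a)) hka.le
  have hB : Tendsto (fun k => Complex.log (q k)) (𝓝[<] (a + 2 * Real.pi))
      (𝓝 ((-s : ℝ) * (Real.pi * Complex.I))) := by
    refine tendsto_log_of_tendsto_neg_one (by rcases hs with rfl | rfl <;> simp)
      (hq_at _ hb ▸ (hqc.tendsto _).mono_left nhdsWithin_le_nhds) ?_
    filter_upwards [nhdsLT_le_nhdsNE _ (hq_im _ hb), self_mem_nhdsWithin] with k hk hka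
    have hka : 0 < a + 2 * Real.pi - k := sub_pos.2 hka
    exact pos_of_mul_pos_left (by linarith : 0 < -s * (q k).im * (a + 2 * Real.pi - k)) hka.le
  rw [windingNumber_sub_eq hω hc h₁ h₂ (fun k hk hks => ?_) hA hB]
  · have : (Real.pi : ℂ) ≠ 0 := by exact_mod_cast Real.pi_ne_zero
    push_cast
    field_simp [Complex.I_ne_zero]
    ring
  · obtain ⟨u, v, hu, hv, huv, hz⟩ := hks
    have hz' : ω ξ + ((u - v) * t : ℝ) * ν = ω (Circle.exp k) := by
      have huv' : (u : ℂ) + v = 1 := by exact_mod_cast huv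
      rw [← hz]
      simp only [Complex.real_smul]
      push_cast
      linear_combination (-ω ξ) * huv'
    have hx : (u - v) * t = 0 := by
      refine hseg _ ?_ ⟨_, hz'.symm⟩
      rw [abs_mul, abs_of_pos ht]
      exact mul_le_of_le_one_left ht.le (abs_le.2 ⟨by linarith, by linarith⟩)
    rw [hx, Complex.ofReal_zero, zero_mul, add_zero] at hz'
    obtain ⟨m, hm⟩ := Circle.exp_eq_exp.1 ((hinj _ hz'.symm).trans ha.symm)
    have hpi := Real.two_pi_pos
    have hm₀ : (0 : ℝ) < m := by
      by_contra! h
      nlinarith [hk.1]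
    have hm₁ : (m : ℝ) < 1 := by
      by_contra! h
      nlinarith [hk.2]
    have : 0 < m := by exact_mod_cast hm₀
    have : m < 1 := by exact_mod_cast hm₁
    omega

/-! ### The curve near a smooth point -/

/-- In the coordinate `p = (z - ω ξ) / ν` the loop passes through a smooth point inside the double
cone `2 |Re p| ≤ |Im p|` based at any nearby point of it, because its velocity is purely imaginary
there. -/
theorem IsC1At.exists_cone {ω : Circle → ℂ} {ξ : Circle} (h : IsC1At ω ξ) {ν : ℂ} {σ : ℝ}
    (hσ : σ ≠ 0) (htan : loopTangent ω ξ / ν = σ * Complex.I) :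
    ∃ δ > 0, ∀ h₁ h₂ : ℝ, |h₁| < δ → |h₂| < δ →
      2 * |((ω (ξ * Circle.exp h₁) - ω (ξ * Circle.exp h₂)) / ν).re| ≤
        |((ω (ξ * Circle.exp h₁) - ω (ξ * Circle.exp h₂)) / ν).im| ∧
      (h₁ ≠ h₂ → 0 < σ * (h₁ - h₂) *
        ((ω (ξ * Circle.exp h₁) - ω (ξ * Circle.exp h₂)) / ν).im) := by
  have hd : HasStrictDerivAt (fun t : ℝ => ω (ξ * Circle.exp t) / ν) (σ * Complex.I) 0 := by
    rw [← htan]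
    simp only [div_eq_mul_inv]
    exact (ContDiffAt.hasStrictDerivAt h one_ne_zero).mul_const ν⁻¹
  have hb := hd.hasStrictFDerivAt.isLittleO.bound (show 0 < |σ| / 3 by positivity)
  obtain ⟨δ, hδ, hball⟩ := Metric.eventually_nhds_iff.1 hb
  refine ⟨δ, hδ, fun h₁ h₂ hh₁ hh₂ => ?_⟩
  have key := hball (y := (h₁, h₂)) (by simpa [Prod.dist_eq] using ⟨hh₁, hh₂⟩)
  rw [sub_div]
  set Δ : ℂ := ω (ξ * Circle.exp h₁) / ν - ω (ξ * Circle.exp h₂) / ν with hΔ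
  have hre := (Complex.abs_re_le_norm _).trans key
  have him := (Complex.abs_im_le_norm _).trans key
  simp only [ContinuousLinearMap.toSpanSingleton_apply, Complex.real_smul, Complex.sub_re,
    Complex.sub_im, Complex.mul_re, Complex.mul_im, Complex.ofReal_re, Complex.ofReal_im,
    Complex.I_re, Complex.I_im, Real.norm_eq_abs, mul_zero, zero_mul, mul_one, sub_zero,
    add_zero] at hre him
  set x := h₁ - h₂ with hx
  have hσx : |x * σ| = |σ| * |x| := by rw [abs_mul, mul_comm]
  have h3 : |x * σ| ≤ |Δ.im| + |Δ.im - x * σ| := by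
    have := abs_sub (Δ.im) (Δ.im - x * σ)
    rwa [sub_sub_cancel] at this
  refine ⟨by linarith, fun hne => ?_⟩
  have hx0 : x ≠ 0 := sub_ne_zero.2 hne
  have hpos : 0 < |x * σ| := abs_pos.2 (mul_ne_zero hx0 hσ)
  have h4 : |Δ.im - x * σ| ≤ |x * σ| / 3 := by linarith
  have h5 : -(x * σ * (Δ.im - x * σ)) ≤ |x * σ| * (|x * σ| / 3) := by
    refine (neg_le_abs _).trans ?_
    rw [abs_mul]
    gcongr
  nlinarith [sq_abs (x * σ)]

/-- A point of the loop that is close to a point without self-intersection has a close parameter. -/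
theorem exists_abs_lt_of_norm_sub_lt {ω : Circle → ℂ} (hc : Continuous ω) {ξ : Circle}
    (hinj : ∀ η, ω η = ω ξ → η = ξ) {δ : ℝ} (hδ : 0 < δ) :
    ∃ r > 0, ∀ η, ‖ω η - ω ξ‖ < r → ∃ h : ℝ, |h| < δ ∧ ξ * Circle.exp h = η := by
  have harg : ContinuousAt (fun η : Circle => Complex.arg (ξ⁻¹ * η : Circle)) ξ := by
    refine ContinuousAt.comp (g := Complex.arg)
      (f := fun η : Circle => ((ξ⁻¹ * η : Circle) : ℂ)) ?_ ?_
    · rw [inv_mul_cancel, Circle.coe_one]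
      exact Complex.continuousAt_arg Complex.one_mem_slitPlane
    · exact (continuous_subtype_val.comp (continuous_const.mul continuous_id)).continuousAt
  have hV : {η : Circle | |Complex.arg (ξ⁻¹ * η : Circle)| < δ} ∈ 𝓝 ξ := by
    have := harg.abs.eventually_lt_const (u := δ) (by simpa using hδ)
    exact this
  obtain ⟨V, hVsub, hVo, hξV⟩ := mem_nhds_iff.1 hV
  have hclosed : IsClosed (ω '' Vᶜ) := (hVo.isClosed_compl.isCompact.image hc).isClosed
  have hmem : ω ξ ∈ (ω '' Vᶜ)ᶜ := by
    rintro ⟨η, hη, heq⟩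
    exact hη (hinj η heq ▸ hξV)
  obtain ⟨r, hr, hball⟩ := Metric.isOpen_iff.1 hclosed.isOpen_compl _ hmem
  refine ⟨r, hr, fun η hη => ⟨Complex.arg (ξ⁻¹ * η : Circle), ?_, ?_⟩⟩
  · by_contra hcon
    exact hball (by rwa [mem_ball_iff_norm]) ⟨η, fun h => hcon (hVsub h), rfl⟩
  · rw [Circle.exp_arg, mul_inv_cancel_left]

/-- A set that near `0` is an arc inside the cones `2 |Re p| ≤ |Im p|` around each of its points
splits a neighborhood of `0` into two sides: every point near `0` off the set can be joined
off the set to `t` or to `-t`. The path goes horizontally, away from the point of the arc at the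
same height, and then vertically. -/
theorem exists_isPreconnected_of_cone {K : Set ℂ} {ρ : ℝ → ℂ} {δ r σ t : ℝ} (hδ : 0 < δ)
    (hρ : Continuous ρ) (hρ₀ : ρ 0 = 0)
    (hcone : ∀ h₁ h₂, |h₁| < δ → |h₂| < δ → 2 * |(ρ h₁ - ρ h₂).re| ≤ |(ρ h₁ - ρ h₂).im|)
    (hmono : ∀ h₁ h₂, |h₁| < δ → |h₂| < δ → h₁ ≠ h₂ → 0 < σ * (h₁ - h₂) * (ρ h₁ - ρ h₂).im)
    (hρK : ∀ h, ρ h ∈ K) (hKρ : ∀ p ∈ K, ‖p‖ < r → ∃ h, |h| < δ ∧ ρ h = p)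
    (ht : 0 < t) (htr : 2 * t < r) :
    ∀ᶠ p in 𝓝 (0 : ℂ), p ∉ K → ∃ C : Set ℂ, IsPreconnected C ∧ C ⊆ Kᶜ ∧ p ∈ C ∧
      ((t : ℂ) ∈ C ∨ -(t : ℂ) ∈ C) := by
  -- Every small height is attained on the arc.
  have hheight : ∀ᶠ y in 𝓝 (0 : ℝ), ∃ h, |h| < δ ∧ (ρ h).im = y := by
    have hδ2 : |δ / 2| < δ := by rw [abs_of_pos (by positivity)]; linarith
    have hδ2' : |-(δ / 2)| < δ := by rwa [abs_neg]
    have h0 : |(0 : ℝ)| < δ := by simpa using hδ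
    have e₁ := hmono (δ / 2) 0 hδ2 h0 (by positivity)
    have e₂ := hmono (-(δ / 2)) 0 hδ2' h0 (by simpa using hδ.ne')
    rw [hρ₀, sub_zero, sub_zero] at e₁ e₂
    have e₁' : 0 < σ * (ρ (δ / 2)).im := by
      refine pos_of_mul_pos_left (?_ : 0 < _ * (δ / 2)) (by positivity)
      linarith
    have e₂' : 0 < -(σ * (ρ (-(δ / 2))).im) := by
      refine pos_of_mul_pos_left (?_ : 0 < _ * (δ / 2)) (by positivity)
      linarith
    have hivt := intermediate_value_uIcc (a := -(δ / 2)) (b := δ / 2)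
      (f := fun h => (ρ h).im) (Complex.continuous_im.comp hρ).continuousOn
    have hnhds : uIcc (ρ (-(δ / 2))).im (ρ (δ / 2)).im ∈ 𝓝 (0 : ℝ) := by
      rcases lt_trichotomy σ 0 with hσ | hσ | hσ
      · rw [uIcc_of_ge (by nlinarith)]
        exact Icc_mem_nhds (by nlinarith) (by nlinarith)
      · simp [hσ] at e₁'
      · rw [uIcc_of_le (by nlinarith)]
        exact Icc_mem_nhds (by nlinarith) (by nlinarith)
    filter_upwards [hnhds] with y hy
    obtain ⟨h, hh, hhy⟩ := hivt hy
    rw [uIcc_of_le (by linarith)] at hh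
    exact ⟨h, abs_lt.2 ⟨by linarith [hh.1], by linarith [hh.2]⟩, hhy⟩
  have him : Tendsto Complex.im (𝓝 0) (𝓝 0) := by
    simpa using Complex.continuous_im.tendsto 0
  filter_upwards [him.eventually hheight, Metric.ball_mem_nhds (0 : ℂ) ht] with p ⟨h₀, hh₀, hp₀⟩ hp
    hpK
  rw [mem_ball_zero_iff] at hp
  have hpim : |p.im| < t := (Complex.abs_im_le_norm p).trans_lt hp
  have hpre : |p.re| < t := (Complex.abs_re_le_norm p).trans_lt hp
  have hcone₀ : ∀ h, |h| < δ → 2 * |(ρ h).re| ≤ |(ρ h).im| := fun h hh => by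
    simpa [hρ₀] using hcone h 0 hh (by simpa using hδ)
  have hx₀ : 2 * |(ρ h₀).re| < t := (hcone₀ h₀ hh₀).trans_lt (hp₀ ▸ hpim)
  have hne : p.re ≠ (ρ h₀).re := fun h => hpK (by
    rw [show p = ρ h₀ from Complex.ext h hp₀.symm]; exact hρK h₀)
  obtain ⟨e, he, hside⟩ : ∃ e : ℝ, (e = 1 ∨ e = -1) ∧ 0 < e * (p.re - (ρ h₀).re) := by
    rcases hne.lt_or_gt with h | h
    · exact ⟨-1, Or.inr rfl, by linarith⟩
    · exact ⟨1, Or.inl rfl, by linarith⟩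
  have hee : e * e = 1 := by rcases he with rfl | rfl <;> norm_num
  have heabs : |e| = 1 := by rcases he with rfl | rfl <;> norm_num
  set c : ℂ := ⟨e * t, p.im⟩ with hcdef
  set d : ℂ := ⟨e * t, 0⟩ with hddef
  have hsmall : ∀ z : ℂ, |z.re| ≤ t → |z.im| < t → ‖z‖ < r := fun z h₁ h₂ =>
    (Complex.norm_le_abs_re_add_abs_im z).trans_lt (by linarith)
  refine ⟨segment ℝ p c ∪ segment ℝ c d, ?_, ?_, Or.inl (left_mem_segment ℝ _ _), ?_⟩
  · exact IsPreconnected.union c (right_mem_segment ℝ _ _) (left_mem_segment ℝ _ _)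
      (convex_segment _ _).isPreconnected (convex_segment _ _).isPreconnected
  · rintro z (⟨u, v, hu, hv, huv, rfl⟩ | ⟨u, v, hu, hv, huv, rfl⟩) hzK
    · have hzim : (u • p + v • c).im = p.im := by
        simp [hcdef, ← add_mul, huv]
      have hzre : (u • p + v • c).re = u * p.re + v * (e * t) := by simp [hcdef]
      have hzabs : |(u • p + v • c).re| ≤ t := by
        rw [hzre]
        calc |u * p.re + v * (e * t)| ≤ |u * p.re| + |v * (e * t)| := abs_add_le _ _
          _ = u * |p.re| + v * t := by
            rw [abs_mul, abs_mul, abs_mul, heabs, abs_of_nonneg hu, abs_of_nonneg hv,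
              abs_of_pos ht, one_mul]
          _ ≤ u * t + v * t := by gcongr
          _ = t := by rw [← add_mul, huv, one_mul]
      obtain ⟨h, hh, hhz⟩ := hKρ _ hzK (hsmall _ hzabs (by rwa [hzim]))
      -- Two points of the arc at the same height coincide.
      have h2 := hcone h h₀ hh hh₀
      rw [Complex.sub_im, hhz, hzim, hp₀, sub_self, abs_zero, Complex.sub_re, hzre] at h2
      have h3 : u * p.re + v * (e * t) = (ρ h₀).re := by
        have := abs_nonneg (u * p.re + v * (e * t) - (ρ h₀).re)
        exact sub_eq_zero.1 (abs_eq_zero.1 (by linarith))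
      have h4 : e * (ρ h₀).re < t := by
        have := le_abs_self (e * (ρ h₀).re)
        rw [abs_mul, heabs, one_mul] at this
        linarith [abs_nonneg (ρ h₀).re]
      have h5 : u * (e * (p.re - (ρ h₀).re)) + v * (t - e * (ρ h₀).re) = 0 := by
        linear_combination e * h3 - t * v * hee - e * (ρ h₀).re * huv
      rcases hu.eq_or_lt with rfl | hu'
      · rw [zero_add] at huv
        rw [huv] at h5
        linarith
      · have : 0 < u * (e * (p.re - (ρ h₀).re)) := mul_pos hu' hside
        have : 0 ≤ v * (t - e * (ρ h₀).re) := mul_nonneg hv (by linarith)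
        linarith
    · have hzim : (u • c + v • d).im = u * p.im := by simp [hcdef, hddef]
      have hzre : (u • c + v • d).re = e * t := by simp [hcdef, hddef, ← add_mul, huv]
      have hzre' : |(u • c + v • d).re| = t := by
        rw [hzre, abs_mul, heabs, abs_of_pos ht, one_mul]
      have hzim' : |(u • c + v • d).im| < t := by
        rw [hzim, abs_mul, abs_of_nonneg hu]
        exact (mul_le_of_le_one_left (abs_nonneg _) (by linarith)).trans_lt hpim
      obtain ⟨h, hh, hhz⟩ := hKρ _ hzK (hsmall _ hzre'.le hzim')
      have h2 := hcone₀ h hh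
      rw [hhz, hzre'] at h2
      linarith
  · have hd : d ∈ segment ℝ p c ∪ segment ℝ c d := Or.inr (right_mem_segment ℝ _ _)
    rcases he with rfl | rfl
    · left
      rwa [show (t : ℂ) = d from Complex.ext (by simp [hddef]) (by simp [hddef])]
    · right
      rwa [show -(t : ℂ) = d from Complex.ext (by simp [hddef]) (by simp [hddef])]

/-! ### Winding numbers of bounded components -/

/-- A unit vector orthogonal to the nonzero vector `τ` is one of the two rotations of `τ / ‖τ‖` by a
right angle. The value `s = 1` stands for the clockwise rotation. -/
theorem exists_sign_of_inner_eq_zero {ν τ : ℂ} (hν : ‖ν‖ = 1) (hτ : τ ≠ 0)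
    (h : inner ℝ ν τ = 0) :
    ∃ s : ℝ, (s = 1 ∨ s = -1) ∧ ν = -s * Complex.I * (τ / (‖τ‖ : ℂ)) := by
  have hν0 : ν ≠ 0 := norm_pos_iff.1 (by rw [hν]; exact one_pos)
  have hτn : (‖τ‖ : ℂ) ≠ 0 := by exact_mod_cast norm_ne_zero_iff.2 hτ
  rw [Complex.inner] at h
  set y : ℝ := (starRingEnd ℂ ν * τ).im with hy
  have hmul : starRingEnd ℂ ν * τ = y * Complex.I := Complex.ext (by rw [mul_comm, h]; simp) (by simp [hy])
  have hνν : ν * starRingEnd ℂ ν = 1 := by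
    rw [Complex.mul_conj, Complex.normSq_eq_norm_sq, hν]; simp
  have hτν : τ = ν * (y * Complex.I) := by
    rw [← hmul, ← mul_assoc, hνν, one_mul]
  have hnorm : ‖τ‖ = |y| := by
    rw [hτν, norm_mul, hν, norm_mul, Complex.norm_I, Complex.norm_real, Real.norm_eq_abs]
    ring
  have hI := Complex.I_mul_I
  rcases abs_choice y with hy' | hy'
  · refine ⟨1, Or.inl rfl, ?_⟩
    have : (y : ℂ) = ‖τ‖ := by rw [hnorm, hy']
    rw [this] at hτν
    rw [mul_div_assoc', eq_div_iff hτn]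
    push_cast
    linear_combination Complex.I * hτν + (‖τ‖ * ν : ℂ) * hI
  · refine ⟨-1, Or.inr rfl, ?_⟩
    have : (y : ℂ) = -‖τ‖ := by rw [hnorm, hy']; simp
    rw [this] at hτν
    rw [mul_div_assoc', eq_div_iff hτn]
    push_cast
    linear_combination -Complex.I * hτν + (‖τ‖ * ν : ℂ) * hI

/-- One smooth boundary point with an outward normal determines the winding number around `D`:
its normal segment starts in the exterior, where the winding number vanishes, and the side of the
curve that the segment reaches by crossing it must be `D`. -/
theorem windingNumber_eq_of_isSmoothPoint {ω : Circle → ℂ} (hω : IsPiecewiseC1 ω)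
    (hc : Continuous ω) {D : Set ℂ} (hD : IsBoundedComponent (range ω) D) {ξ : Circle}
    (hξ : ω ξ ∈ frontier D) (hsm : IsSmoothPoint ω ξ) {ν : ℂ} (hν : IsOutwardUnitNormal ω ξ ν)
    {s : ℝ} (hs : s = 1 ∨ s = -1)
    (hνs : ν = -s * Complex.I * (loopTangent ω ξ / (‖loopTangent ω ξ‖ : ℂ)))
    {w : ℂ} (hw : w ∈ D) : windingNumber ω w = s := by
  obtain ⟨hC1, hτ, hinj⟩ := hsm
  obtain ⟨hν₁, -, hext⟩ := hν
  obtain ⟨⟨w₀, hw₀, hDw₀⟩, hDb⟩ := hD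
  have hDpre : IsPreconnected D := hDw₀ ▸ isPreconnected_connectedComponentIn
  have hDsub : D ⊆ (range ω)ᶜ := hDw₀ ▸ connectedComponentIn_subset _ _
  have hν0 : ν ≠ 0 := norm_pos_iff.1 (by rw [hν₁]; exact one_pos)
  have hs0 : s ≠ 0 := by rcases hs with rfl | rfl <;> norm_num
  have hss : s * s = 1 := by rcases hs with rfl | rfl <;> norm_num
  have hτpos : 0 < ‖loopTangent ω ξ‖ := norm_pos_iff.2 hτ
  have htan : loopTangent ω ξ / ν = ((s * ‖loopTangent ω ξ‖ : ℝ) : ℂ) * Complex.I := by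
    have hτn : (‖loopTangent ω ξ‖ : ℂ) ≠ 0 := by exact_mod_cast hτpos.ne'
    have hssC : (s : ℂ) * s = 1 := by exact_mod_cast hss
    have h1 : (‖loopTangent ω ξ‖ : ℂ) * ν = -s * Complex.I * loopTangent ω ξ := by
      conv_lhs => rw [hνs]
      field_simp
    rw [div_eq_iff hν0]
    push_cast
    linear_combination (-s * Complex.I) * h1 - loopTangent ω ξ * hssC +
      (s * s * loopTangent ω ξ) * Complex.I_mul_I
  obtain ⟨δ, hδ, hcone⟩ := hC1.exists_cone (mul_ne_zero hs0 hτpos.ne') htan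
  obtain ⟨r, hr, harc⟩ := exists_abs_lt_of_norm_sub_lt hc hinj hδ
  set ρ : ℝ → ℂ := fun h => (ω (ξ * Circle.exp h) - ω ξ) / ν with hρdef
  have hρ : Continuous ρ :=
    ((hc.comp (continuous_const.mul Circle.exp.continuous)).sub continuous_const).div_const ν
  have hρ₀ : ρ 0 = 0 := by simp [hρdef]
  have hρsub : ∀ h₁ h₂, ρ h₁ - ρ h₂ = (ω (ξ * Circle.exp h₁) - ω (ξ * Circle.exp h₂)) / ν :=
    fun h₁ h₂ => by simp only [hρdef]; rw [← sub_div, sub_sub_sub_cancel_right]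
  have hωρ : ∀ h, ω ξ + ρ h * ν = ω (ξ * Circle.exp h) := fun h => by
    simp only [hρdef]; rw [div_mul_cancel₀ _ hν0, add_sub_cancel]
  simp only [← hρsub] at hcone
  -- The loop in the coordinate `p = (z - ω ξ) / ν`.
  set K : Set ℂ := {p | ω ξ + p * ν ∈ range ω} with hKdef
  have hKρ : ∀ p ∈ K, ‖p‖ < r → ∃ h, |h| < δ ∧ ρ h = p := by
    rintro p ⟨η, hη⟩ hp
    obtain ⟨h, hh, rfl⟩ := harc η (by rw [hη, add_sub_cancel_left, norm_mul, hν₁, mul_one]; exact hp)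
    exact ⟨h, hh, mul_right_cancel₀ hν0 (add_left_cancel ((hωρ h).trans hη))⟩
  obtain ⟨t, hext_t, htr, ht⟩ : ∃ t : ℝ, ω ξ + t * ν ∈ exteriorComponent (range ω) ∧
      t < r / 2 ∧ 0 < t :=
    (hext.and ((eventually_nhdsWithin_of_eventually_nhds
      (eventually_lt_nhds (by positivity : (0 : ℝ) < r / 2))).and self_mem_nhdsWithin)).exists
  have hjump := windingNumber_sub_eq_of_crossing hω hc hinj hν0 ht hs
    (fun x hx hxK => by
      obtain ⟨h, hh, hhx⟩ := hKρ (x : ℂ) hxK (by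
        rw [Complex.norm_real, Real.norm_eq_abs]; linarith)
      have := (hcone h 0 hh (by simpa using hδ)).1
      rw [hρ₀, sub_zero, hhx, Complex.ofReal_re, Complex.ofReal_im, abs_zero] at this
      exact abs_eq_zero.1 (by linarith [abs_nonneg x]))
    (by
      have hnear : ∀ᶠ h : ℝ in 𝓝[≠] 0, |h| < δ := eventually_nhdsWithin_of_eventually_nhds (by
        filter_upwards [Metric.ball_mem_nhds (0 : ℝ) hδ] with h hh
        simpa using hh)
      filter_upwards [hnear, self_mem_nhdsWithin] with h hh hne
      have := (hcone h 0 hh (by simpa using hδ)).2 hne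
      rw [hρ₀, sub_zero, sub_zero] at this
      refine pos_of_mul_pos_left (?_ : 0 < _ * ‖loopTangent ω ξ‖) hτpos.le
      simp only [hρdef] at this
      linarith)
  rw [windingNumber_eq_zero_of_mem_exteriorComponent hω hc hext_t, zero_sub, neg_inj] at hjump
  rw [← hjump]
  have hsides := exists_isPreconnected_of_cone (K := K) hδ hρ hρ₀
    (fun h₁ h₂ hh₁ hh₂ => (hcone h₁ h₂ hh₁ hh₂).1) (fun h₁ h₂ hh₁ hh₂ => (hcone h₁ h₂ hh₁ hh₂).2)
    (fun h => ⟨_, (hωρ h).symm⟩) hKρ ht (by linarith)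
  have hcoord : Tendsto (fun z => (z - ω ξ) / ν) (𝓝 (ω ξ)) (𝓝 0) := by
    have : Continuous fun z : ℂ => (z - ω ξ) / ν := (continuous_id.sub continuous_const).div_const ν
    simpa using this.tendsto (ω ξ)
  obtain ⟨z, hzD, hz⟩ := ((mem_closure_iff_frequently.1
    (frontier_subset_closure hξ)).and_eventually (hcoord.eventually hsides)).exists
  have hzz : ω ξ + (z - ω ξ) / ν * ν = z := by rw [div_mul_cancel₀ _ hν0, add_sub_cancel]
  obtain ⟨C, hC, hCK, hzC, htC⟩ := hz (fun h => hDsub hzD (by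
    rw [hKdef, mem_ofPred_eq, hzz] at h; exact h))
  set C' : Set ℂ := (fun p => ω ξ + p * ν) '' C with hC'def
  have hC' : IsPreconnected C' :=
    hC.image _ (continuous_const.add (continuous_id.mul continuous_const)).continuousOn
  have hC'sub : C' ⊆ (range ω)ᶜ := by rintro _ ⟨p, hp, rfl⟩; exact hCK hp
  have hzC' : z ∈ C' := ⟨_, hzC, hzz⟩
  rcases htC with htC | htC
  · -- This side of the curve lies in the exterior, so it cannot meet `D`.
    exfalso
    have h1 := connectedComponentIn_eq (hC'.subset_connectedComponentIn hzC' hC'sub ⟨_, htC, rfl⟩)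
    have h2 : connectedComponentIn (range ω)ᶜ z = D := by
      rw [hDw₀] at hzD ⊢
      exact (connectedComponentIn_eq hzD).symm
    refine hext_t.2 ?_
    rw [← h1, h2]
    exact hDb
  · have h1 := windingNumber_eq_of_isPreconnected hω hc hC' hC'sub hzC' ⟨_, htC, rfl⟩
    rw [windingNumber_eq_of_isPreconnected hω hc hDpre hDsub hw hzD, h1]
    congr 1
    ring

theorem IsSimpleClosedCurve.infinite {J : Set ℂ} (hJ : IsSimpleClosedCurve J) : J.Infinite := by
  obtain ⟨c, -, hinj, rfl⟩ := hJ
  have : Infinite Circle := Set.infinite_univ_iff.1 <|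
    (Set.infinite_of_injOn_mapsTo (Circle.exp_injOn_Ico (a := 0) (b := 1)
      (by linarith [Real.two_le_pi])) (fun _ _ => mem_univ _) (Set.Ico_infinite one_pos))
  exact Set.infinite_range_of_injective hinj

theorem mainTheorem4 (pc : PhotonicCrystal) (ω : Circle → ℂ) (hband : pc.IsBand ω)
    (hω : IsPiecewiseC1 ω) (D : Set ℂ) (hD : IsBoundedComponent (Set.range ω) D)
    (hJ : HasJordanBoundary ω D) :
    (IsPositivelyOriented ω D → ∀ w ∈ D, windingNumber ω w = 1) ∧
    (IsNegativelyOriented ω D → ∀ w ∈ D, windingNumber ω w = -1) := by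
  refine ⟨fun hpos w hw => ?_, fun hneg w hw => ?_⟩
  · obtain ⟨ζ, hζ, hζs⟩ := (hJ.simple.infinite.sdiff hJ.corners).nonempty
    obtain ⟨ξ, rfl, hsm⟩ : ∃ ξ, ω ξ = ζ ∧ IsSmoothPoint ω ξ := by
      by_contra h
      exact hζs ⟨hζ, h⟩
    obtain ⟨ν, hν⟩ := hJ.normal ξ hζ hsm
    have h := windingNumber_eq_of_isSmoothPoint hω hband.1 hD hζ hsm hν (s := 1) (Or.inl rfl)
      (by simpa using hpos ξ hζ hsm ν hν) hw
    simpa using h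
  · simp only [IsNegativelyOriented, IsPositivelyOriented, not_forall] at hneg
    obtain ⟨ξ, hζ, hsm, ν, hν, hne⟩ := hneg
    obtain ⟨s, hs, hνs⟩ := exists_sign_of_inner_eq_zero hν.1 hsm.2.1 hν.2.1
    have hs' : s = -1 := hs.resolve_left (by rintro rfl; exact hne (by simpa using hνs))
    have h := windingNumber_eq_of_isSmoothPoint hω hband.1 hD hζ hsm hν hs hνs hw
    simpa [hs'] using h
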